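/- Let $k$ be a field, let $A=k[x_1,\dots,x_p]$ and $B=k[y_1,\dots,y_q]$ be polynomial rings in disjoint finite sets of variables, with the standard grading, and let $R=A\otimes_k B=k[x_1,\dots,x_p,y_1,\dots,y_q]$. Let $I\subset A$ and $J\subset B$ be nonzero proper homogeneous ideals. Then there is a nonzero proper homogeneous ideal $Q$ in a polynomial ring $S$ over $k$ in finitely many variables such that, for all $n>0$, $$\operatorname{depth} S/Q^n=\operatorname{depth} A/I^n+\operatorname{depth} B/J^n ,$$ and such that $Q$ is a monomial ideal if $I$ and $J$ are monomial ideals. More precisely, $p,q\ge 1$, and for every variable $x$ of $A$ and every variable $y$ of $B$ one may take for $S$ the ring $R/(x-y)$, identified with a polynomial ring over $k$ in such a way that the variables of $R$ are mapped to variables of $S$, and for $Q$ the image in $S$ of the ideal $IJ$ of $R$ (the product of the extensions of $I$ and $J$ to $R$). Here the depth of a nonzero quotient of a polynomial ring by a homogeneous ideal is the maximal length of a regular sequence on it consisting of elements of the ideal generated by the variables. -/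

import Mathlib

/-- The depth (grade) of a module `M` with respect to an ideal `𝔞`: the supremum of the lengths of
the `M`-regular sequences contained in `𝔞`, with the usual convention that it is `∞` if
`𝔞 M = M` (in particular for `M = 0`). -/
noncomputable def idealDepth {R : Type*} [CommRing R] (𝔞 : Ideal R)
    (M : Type*) [AddCommGroup M] [Module R M] : ℕ∞ :=
  open Classical in
  if 𝔞 • (⊤ : Submodule R M) = ⊤ then ⊤
  else ⨆ (rs : List R) (_ : (∀ r ∈ rs, r ∈ 𝔞) ∧ RingTheory.Sequence.IsRegular M rs),
    (rs.length : ℕ∞)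

/-- `depth A/I` for an ideal `I` of a polynomial ring `A = k[X_s : s ∈ σ]`: the depth of the
`A`-module `A/I` with respect to the maximal homogeneous ideal `(X_s : s ∈ σ)` of `A`. -/
noncomputable def quotDepth {k : Type*} [Field k] {σ : Type*} (I : Ideal (MvPolynomial σ k)) :
    ℕ∞ :=
  idealDepth (MvPolynomial.idealOfVars σ k) (MvPolynomial σ k ⧸ I)

/-- A monomial ideal: an ideal generated by monomials. -/
def IsMonomialIdeal {k : Type*} [Field k] {σ : Type*} (I : Ideal (MvPolynomial σ k)) : Prop :=
  ∃ T : Set (σ →₀ ℕ), I = Ideal.span ((fun e => MvPolynomial.monomial e (1 : k)) '' T)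

/-- A homogeneous ideal of `k[X_s : s ∈ σ]`, for the standard grading (every variable has
degree one). -/
def IsHomogIdeal {k : Type*} [Field k] {σ : Type*} (I : Ideal (MvPolynomial σ k)) : Prop :=
  letI := MvPolynomial.gradedAlgebra (σ := σ) (R := k)
  I.IsHomogeneous (MvPolynomial.homogeneousSubmodule σ k)

/-- For ideals `I` of `A = k[σ]` and `J` of `B = k[τ]`, the product of their extensions to the
polynomial ring `R = A ⊗ B = k[σ ⊔ τ]` in the disjoint union of the two sets of variables. -/
noncomputable def extProd {k : Type*} [Field k] {σ τ : Type*}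
    (I : Ideal (MvPolynomial σ k)) (J : Ideal (MvPolynomial τ k)) :
    Ideal (MvPolynomial (σ ⊕ τ) k) :=
  I.map (MvPolynomial.rename (R := k) (Sum.inl : σ → σ ⊕ τ)) *
    J.map (MvPolynomial.rename (R := k) (Sum.inr : τ → σ ⊕ τ))

/-!
Write `A = k[σ]`, `B = k[τ]`, `R = k[σ ⊔ τ] = A ⊗ B`, and let `I ⊆ A`, `J ⊆ B` be nonzero ideals
inside the ideals of the variables. Since `(IJ)ⁿ = IⁿJⁿ`, it suffices to compute the depth of
`R/(IJ, x - y)` for every such pair, and then to apply the result to `Iⁿ` and `Jⁿ`.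

* If `a` and `b` are maximal regular sequences on `A/I` and `B/J`, then, by flatness over `k`, their
  concatenation is regular on `A/I ⊗ B/J = R/(I + J)`, and the product of socle elements is a socle
  element. Hence `depth R/(I + J) = r + s` with `r = depth A/I` and `s = depth B/J`
  (`HasRegularSequence.extLeft_sup_extRight`, `not_hasRegularSequence_extLeft_sup_extRight`).
* Since `J ≠ 0`, the Krull dimension of `B/J` is less than that of `B`, so `s` is less than the
  number of variables of `B`. The variables of `B` being regular on `B`, this gives
  `depth R/IR ≥ r + s + 1`, and symmetrically for `R/JR`
  (`hasRegularSequence_extLeft_and_extRight`).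
* Over a field `IR ∩ JR = IJ` (`extLeft_inf_extRight`), and the depth lemma for
  `0 → R/IJ → R/IR × R/JR → R/(I + J) → 0` gives `depth R/IJ = r + s + 1`
  (`HasRegularSequence.inf`, `HasRegularSequence.sup`).
* `x - y` is a nonzerodivisor modulo `IR` and modulo `JR`, hence modulo `IJ`
  (`mem_extProd_of_X_sub_X_mul_mem`), so that dividing by it lowers the depth to `r + s`
  (`hasRegularSequence_sup_span_iff`).

The steps that compare depths rest on the Rees theorem, which expresses the existence of a regular
sequence of length `n` by the vanishing of `Ext` groups in degrees below `n`.
-/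

open RingTheory.Sequence CategoryTheory CategoryTheory.Abelian
open MvPolynomial TensorProduct

/-! ### Regular sequences on quotients by ideals -/

section RegularSequences

variable {R : Type*} [CommRing R]

theorem isSMulRegular_quotient_iff (I : Ideal R) (x : R) :
    IsSMulRegular (R ⧸ I) x ↔ ∀ f, x * f ∈ I → f ∈ I := by
  rw [isSMulRegular_iff_right_eq_zero_of_smul]
  constructor
  · intro h f hf
    exact Ideal.Quotient.eq_zero_iff_mem.1 (h (Ideal.Quotient.mk I f)
      (by rw [← Ideal.Quotient.eq_zero_iff_mem] at hf; simpa [Algebra.smul_def] using hf))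
  · intro h m hm
    obtain ⟨f, rfl⟩ := Ideal.Quotient.mk_surjective m
    rw [Ideal.Quotient.eq_zero_iff_mem]
    apply h
    rw [← Ideal.Quotient.eq_zero_iff_mem]
    simpa [Algebra.smul_def] using hm

/-- `(R/I)/x(R/I)` is `R/(I + (x))`. -/
noncomputable def quotSMulTopQuotientEquiv (I : Ideal R) (x : R) :
    QuotSMulTop x (R ⧸ I) ≃ₗ[R] R ⧸ (I ⊔ Ideal.span {x}) :=
  (Submodule.quotEquivOfEq _ _ (by
    rw [← Submodule.ideal_span_singleton_smul, Ideal.smul_top_eq_map]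
    ext m
    rw [Submodule.restrictScalars_mem, Submodule.mem_map, Ideal.Quotient.algebraMap_eq,
      Ideal.mem_map_iff_of_surjective _ Ideal.Quotient.mk_surjective]
    rfl)).trans (Submodule.quotientQuotientEquivQuotientSup I (Ideal.span {x}))

theorem isWeaklyRegular_quotient_cons_iff (I : Ideal R) (x : R) (rs : List R) :
    IsWeaklyRegular (R ⧸ I) (x :: rs) ↔
      (∀ f, x * f ∈ I → f ∈ I) ∧ IsWeaklyRegular (R ⧸ (I ⊔ Ideal.span {x})) rs := by
  rw [isWeaklyRegular_cons_iff, isSMulRegular_quotient_iff,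
    (quotSMulTopQuotientEquiv I x).isWeaklyRegular_congr]

theorem isWeaklyRegular_quotient_append_iff (I : Ideal R) (rs ss : List R) :
    IsWeaklyRegular (R ⧸ I) (rs ++ ss) ↔
      IsWeaklyRegular (R ⧸ I) rs ∧ IsWeaklyRegular (R ⧸ (I ⊔ Ideal.ofList rs)) ss := by
  induction rs generalizing I with
  | nil =>
    rw [Ideal.ofList_nil, sup_bot_eq]
    simp
  | cons x rs ih =>
    rw [List.cons_append, isWeaklyRegular_quotient_cons_iff, isWeaklyRegular_quotient_cons_iff, ih,
      Ideal.ofList_cons, sup_assoc, and_assoc]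

theorem smul_top_quotient_ne_top {𝔪 I : Ideal R} (h𝔪 : 𝔪 ≠ ⊤) (hI : I ≤ 𝔪) :
    𝔪 • (⊤ : Submodule R (R ⧸ I)) ≠ ⊤ := by
  intro h
  have h1 : (1 : R ⧸ I) ∈ 𝔪 • (⊤ : Submodule R (R ⧸ I)) := by
    rw [h]
    trivial
  rw [Ideal.smul_top_eq_map, Submodule.restrictScalars_mem, Ideal.Quotient.algebraMap_eq,
    Ideal.mem_map_iff_of_surjective _ Ideal.Quotient.mk_surjective] at h1
  obtain ⟨f, hf, hf1⟩ := h1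
  refine h𝔪 ((Ideal.eq_top_iff_one _).2 ?_)
  rw [← map_one (Ideal.Quotient.mk I), Ideal.Quotient.mk_eq_mk_iff_sub_mem] at hf1
  simpa using 𝔪.sub_mem hf (hI hf1)

/-- For sequences in a proper ideal containing `I`, the nontriviality condition in `IsRegular` is
automatic. -/
theorem isRegular_quotient_iff {𝔪 I : Ideal R} (h𝔪 : 𝔪 ≠ ⊤) (hI : I ≤ 𝔪) {rs : List R}
    (hrs : ∀ r ∈ rs, r ∈ 𝔪) : IsRegular (R ⧸ I) rs ↔ IsWeaklyRegular (R ⧸ I) rs := by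
  refine ⟨fun h => h.toIsWeaklyRegular, fun h => ⟨h, fun htop => ?_⟩⟩
  refine smul_top_quotient_ne_top h𝔪 hI (top_le_iff.1 (htop.le.trans ?_))
  exact Submodule.smul_mono_left (Ideal.span_le.2 hrs)

/-- There is an `R/I`-regular sequence of length `n` in `𝔪`. -/
def HasRegularSequence (𝔪 I : Ideal R) (n : ℕ) : Prop :=
  ∃ rs : List R, rs.length = n ∧ (∀ r ∈ rs, r ∈ 𝔪) ∧ IsWeaklyRegular (R ⧸ I) rs

theorem HasRegularSequence.mono {𝔪 I : Ideal R} {m n : ℕ} (h : HasRegularSequence 𝔪 I n)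
    (hmn : m ≤ n) : HasRegularSequence 𝔪 I m := by
  obtain ⟨rs, rfl, hrs, hreg⟩ := h
  refine ⟨rs.take m, by simpa using hmn, fun r hr => hrs r (List.mem_of_mem_take hr), ?_⟩
  rw [← List.take_append_drop m rs, isWeaklyRegular_quotient_append_iff] at hreg
  exact hreg.1

/-- The depth is the length `d` of a regular sequence in `𝔪` as soon as none of length
`d + 1` exists. -/
theorem idealDepth_quotient_eq {𝔪 I : Ideal R} (h𝔪 : 𝔪 ≠ ⊤) (hI : I ≤ 𝔪) {d : ℕ}
    (hd : HasRegularSequence 𝔪 I d) (hd' : ¬ HasRegularSequence 𝔪 I (d + 1)) :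
    idealDepth 𝔪 (R ⧸ I) = d := by
  rw [idealDepth, if_neg (smul_top_quotient_ne_top h𝔪 hI)]
  apply le_antisymm
  · refine iSup₂_le fun rs hrs => ?_
    by_contra! hlt
    exact hd' (HasRegularSequence.mono ⟨rs, rfl, hrs.1, hrs.2.toIsWeaklyRegular⟩
      (by exact_mod_cast hlt))
  · obtain ⟨rs, rfl, hrs, hreg⟩ := hd
    exact le_iSup₂_of_le rs ⟨hrs, (isRegular_quotient_iff h𝔪 hI hrs).2 hreg⟩ le_rfl

theorem isWeaklyRegular_quotient_map_iff {S : Type*} [CommRing S] {π : R →+* S}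
    (hπ : Function.Surjective π) (Q : Ideal S) (rs : List R) :
    IsWeaklyRegular (S ⧸ Q) (rs.map π) ↔ IsWeaklyRegular (R ⧸ Q.comap π) rs := by
  induction rs generalizing Q with
  | nil => simp
  | cons x rs ih =>
    have hsup : (Q ⊔ Ideal.span {π x}).comap π = Q.comap π ⊔ Ideal.span {x} := by
      have : Q ⊔ Ideal.span {π x} = (Q.comap π ⊔ Ideal.span {x}).map π := by
        rw [Ideal.map_sup, Ideal.map_comap_of_surjective _ hπ, Ideal.map_span,
          Set.image_singleton]
      rw [this, Ideal.comap_map_of_surjective _ hπ, sup_eq_left]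
      exact (Ideal.comap_mono bot_le).trans le_sup_left
    rw [List.map_cons, isWeaklyRegular_quotient_cons_iff, isWeaklyRegular_quotient_cons_iff, ih,
      hsup]
    refine and_congr_left fun _ => ⟨fun h f hf => h _ (by simpa using hf), fun h f hf => ?_⟩
    obtain ⟨g, rfl⟩ := hπ f
    exact h g (by simpa using hf)

theorem hasRegularSequence_map_iff {S : Type*} [CommRing S] {π : R →+* S}
    (hπ : Function.Surjective π) (𝔪 : Ideal R) (Q : Ideal S) (n : ℕ) :
    HasRegularSequence (𝔪.map π) Q n ↔ HasRegularSequence 𝔪 (Q.comap π) n := by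
  constructor
  · rintro ⟨rs, rfl, hrs, hreg⟩
    have : ∃ ts : List R, (∀ t ∈ ts, t ∈ 𝔪) ∧ ts.map π = rs := by
      clear hreg
      induction rs with
      | nil => exact ⟨[], by simp⟩
      | cons r rs ih =>
        obtain ⟨t, ht, rfl⟩ := (Ideal.mem_map_iff_of_surjective π hπ).1 (hrs r (by simp))
        obtain ⟨ts, hts, rfl⟩ := ih fun r hr => hrs r (by simp [hr])
        exact ⟨t :: ts, by simpa [ht] using hts, rfl⟩
    obtain ⟨ts, hts, rfl⟩ := this
    exact ⟨ts, by simp, hts, (isWeaklyRegular_quotient_map_iff hπ Q ts).1 hreg⟩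
  · rintro ⟨ts, rfl, hts, hreg⟩
    refine ⟨ts.map π, by simp, ?_, (isWeaklyRegular_quotient_map_iff hπ Q ts).2 hreg⟩
    intro r hr
    obtain ⟨t, ht, rfl⟩ := List.mem_map.1 hr
    exact Ideal.mem_map_of_mem π (hts t ht)

/-- Depth may be computed over a ring or over a quotient of it. -/
theorem hasRegularSequence_map_map_iff {S F : Type*} [CommRing S] [FunLike F R S]
    [RingHomClass F R S] {π : F} (hπ : Function.Surjective π) (𝔪 K : Ideal R) (n : ℕ) :
    HasRegularSequence (𝔪.map π) (K.map π) n ↔ HasRegularSequence 𝔪 (K ⊔ RingHom.ker π) n := by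
  have h : (K.map π).comap (π : R →+* S) = K ⊔ RingHom.ker π :=
    Ideal.comap_map_of_surjective π hπ K
  rw [← h]
  exact hasRegularSequence_map_iff (π := (π : R →+* S)) hπ 𝔪 (K.map π) n

/-- Prime avoidance: if no element of `𝔪` is a nonzerodivisor on `R/I`, then `𝔪` annihilates a
nonzero element of `R/I`. -/
theorem exists_socle_of_forall_zeroDivisor [IsNoetherianRing R] {𝔪 I : Ideal R}
    (h : ∀ x ∈ 𝔪, ¬ ∀ f, x * f ∈ I → f ∈ I) : ∃ f ∉ I, ∀ x ∈ 𝔪, x * f ∈ I := by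
  have hle : (𝔪 : Set R) ⊆ ⋃ p ∈ associatedPrimes R (R ⧸ I), (p : Set R) := by
    rw [biUnion_associatedPrimes_eq_zero_divisors]
    intro x hx
    have := h x hx
    push Not at this
    obtain ⟨f, hf, hfI⟩ := this
    refine ⟨Ideal.Quotient.mk I f, fun h0 => hfI (Ideal.Quotient.eq_zero_iff_mem.1 h0), ?_⟩
    exact Ideal.Quotient.eq_zero_iff_mem.2 hf
  obtain ⟨P, hP, hle⟩ := (𝔪.subset_union_prime_finite (associatedPrimes.finite R (R ⧸ I))
    (f := id) 0 0 fun _ h _ _ ↦ h.1).1 hle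
  rw [AssociatedPrimes.mem_iff, isAssociatedPrime_iff] at hP
  obtain ⟨prime, m, rfl⟩ := hP
  obtain ⟨f, rfl⟩ := Ideal.Quotient.mk_surjective m
  refine ⟨f, fun hf => prime.ne_top ?_, fun x hx => ?_⟩
  · rw [Ideal.Quotient.eq_zero_iff_mem.2 hf]
    simp
  · have h0 : x • Ideal.Quotient.mk I f = 0 := by
      simpa [Submodule.mem_colon_singleton] using! hle hx
    exact Ideal.Quotient.eq_zero_iff_mem.1 h0

end RegularSequences

/-! ### The Rees theorem and the depth lemma -/

section Rees

universe u

variable {R : Type u} [CommRing R]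

/-- The Rees theorem for `R/I`. -/
theorem hasRegularSequence_iff_ext [IsNoetherianRing R] {𝔪 I : Ideal R} (h𝔪 : 𝔪 ≠ ⊤) (hI : I ≤ 𝔪)
    (n : ℕ) : HasRegularSequence 𝔪 I n ↔
      ∀ i < n, Subsingleton
        (Ext (ModuleCat.of R (Shrink.{u} (R ⧸ 𝔪))) (ModuleCat.of R (R ⧸ I)) i) := by
  refine Iff.trans ?_ ((ModuleCat.exists_isRegular_tfae 𝔪 n (ModuleCat.of R (R ⧸ I))
    (smul_top_quotient_ne_top h𝔪 hI).lt_top).out 3 1)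
  refine exists_congr fun rs => and_congr_right fun _ => and_congr_right fun hrs => ?_
  exact (isRegular_quotient_iff h𝔪 hI hrs).symm

theorem subsingleton_ext_of_shortExact₁ {S : ShortComplex (ModuleCat.{u} R)} (hS : S.ShortExact)
    (N : ModuleCat.{u} R) {i j : ℕ} (hij : i + 1 = j) (h₃ : Subsingleton (Ext N S.X₃ i))
    (h₂ : Subsingleton (Ext N S.X₂ j)) : Subsingleton (Ext N S.X₁ j) := by
  refine subsingleton_of_forall_eq 0 fun x => ?_
  obtain ⟨y, rfl⟩ := Ext.covariant_sequence_exact₁ N hS x (Subsingleton.elim _ _) hij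
  rw [Subsingleton.elim y 0, Ext.zero_comp]

theorem subsingleton_ext_of_shortExact₁_zero {S : ShortComplex (ModuleCat.{u} R)}
    (hS : S.ShortExact) (N : ModuleCat.{u} R) (h₂ : Subsingleton (Ext N S.X₂ 0)) :
    Subsingleton (Ext N S.X₁ 0) :=
  have := hS.mono_f
  (Ext.postcomp_mk₀_injective_of_mono N S.f).subsingleton

theorem subsingleton_ext_of_shortExact₂ {S : ShortComplex (ModuleCat.{u} R)} (hS : S.ShortExact)
    (N : ModuleCat.{u} R) {i : ℕ} (h₁ : Subsingleton (Ext N S.X₁ i))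
    (h₃ : Subsingleton (Ext N S.X₃ i)) : Subsingleton (Ext N S.X₂ i) := by
  refine subsingleton_of_forall_eq 0 fun x => ?_
  obtain ⟨y, rfl⟩ := Ext.covariant_sequence_exact₂ N hS x (Subsingleton.elim _ _)
  rw [Subsingleton.elim y 0, Ext.zero_comp]

theorem subsingleton_ext_of_shortExact₃ {S : ShortComplex (ModuleCat.{u} R)} (hS : S.ShortExact)
    (N : ModuleCat.{u} R) {i j : ℕ} (hij : i + 1 = j) (h₂ : Subsingleton (Ext N S.X₂ i))
    (h₁ : Subsingleton (Ext N S.X₁ j)) : Subsingleton (Ext N S.X₃ i) := by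
  refine subsingleton_of_forall_eq 0 fun x => ?_
  obtain ⟨y, rfl⟩ := Ext.covariant_sequence_exact₃ N hS x hij (Subsingleton.elim _ _)
  rw [Subsingleton.elim y 0, Ext.zero_comp]

/-- Dividing by a nonzerodivisor of `𝔪` lowers the depth by exactly one. -/
theorem hasRegularSequence_sup_span_iff [IsNoetherianRing R] {𝔪 I : Ideal R} (h𝔪 : 𝔪 ≠ ⊤)
    (hI : I ≤ 𝔪) {x : R} (hx : x ∈ 𝔪) (hreg : ∀ f, x * f ∈ I → f ∈ I) (n : ℕ) :
    HasRegularSequence 𝔪 (I ⊔ Ideal.span {x}) n ↔ HasRegularSequence 𝔪 I (n + 1) := by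
  constructor
  · rintro ⟨rs, rfl, hrs, hw⟩
    exact ⟨x :: rs, by simp, by simpa [hx] using hrs,
      (isWeaklyRegular_quotient_cons_iff I x rs).2 ⟨hreg, hw⟩⟩
  · intro h
    have hI' : I ⊔ Ideal.span {x} ≤ 𝔪 := sup_le hI (by simpa [Ideal.span_le] using hx)
    rw [hasRegularSequence_iff_ext h𝔪 hI] at h
    rw [hasRegularSequence_iff_ext h𝔪 hI']
    intro i hi
    have hS := IsSMulRegular.smulShortComplex_shortExact (M := ModuleCat.of R (R ⧸ I))
      ((isSMulRegular_quotient_iff I x).2 hreg)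
    have := subsingleton_ext_of_shortExact₃ hS (ModuleCat.of R (Shrink.{u} (R ⧸ 𝔪))) rfl
      (h i (by omega)) (h (i + 1) (by omega))
    exact (((Abelian.extFunctorObj (ModuleCat.of R (Shrink.{u} (R ⧸ 𝔪))) i).mapIso
      (quotSMulTopQuotientEquiv I x).toModuleIso).addCommGroupIsoToAddEquiv).subsingleton_congr.1
        this

theorem hasRegularSequence_sup_ofList_iff [IsNoetherianRing R] {𝔪 I : Ideal R} (h𝔪 : 𝔪 ≠ ⊤)
    (hI : I ≤ 𝔪) {rs : List R} (hrs : ∀ r ∈ rs, r ∈ 𝔪) (hreg : IsWeaklyRegular (R ⧸ I) rs)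
    (n : ℕ) :
    HasRegularSequence 𝔪 (I ⊔ Ideal.ofList rs) n ↔ HasRegularSequence 𝔪 I (n + rs.length) := by
  induction rs generalizing I with
  | nil => simp
  | cons x rs ih =>
    have hx : x ∈ 𝔪 := hrs x (by simp)
    rw [isWeaklyRegular_quotient_cons_iff] at hreg
    rw [Ideal.ofList_cons, ← sup_assoc, ih (sup_le hI (by simpa [Ideal.span_le] using hx))
      (fun r hr => hrs r (by simp [hr])) hreg.2,
      hasRegularSequence_sup_span_iff h𝔪 hI hx hreg.1, List.length_cons, add_assoc]

/-- A regular sequence is of maximal length exactly when `𝔪` annihilates a nonzero element of the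
quotient by it. -/
theorem exists_socle_iff_not_hasRegularSequence [IsNoetherianRing R] {𝔪 I : Ideal R} (h𝔪 : 𝔪 ≠ ⊤)
    (hI : I ≤ 𝔪) {rs : List R} (hrs : ∀ r ∈ rs, r ∈ 𝔪) (hreg : IsWeaklyRegular (R ⧸ I) rs) :
    (∃ f ∉ I ⊔ Ideal.ofList rs, ∀ x ∈ 𝔪, x * f ∈ I ⊔ Ideal.ofList rs) ↔
      ¬ HasRegularSequence 𝔪 I (rs.length + 1) := by
  rw [add_comm, ← hasRegularSequence_sup_ofList_iff h𝔪 hI hrs hreg]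
  constructor
  · rintro ⟨f, hf, hsoc⟩ ⟨ts, hlen, hts, ht⟩
    obtain ⟨x, rfl⟩ := List.length_eq_one_iff.1 hlen
    exact hf (((isWeaklyRegular_quotient_cons_iff _ _ _).1 ht).1 f (hsoc x (hts x (by simp))))
  · intro h
    refine exists_socle_of_forall_zeroDivisor fun x hx hxr => h ⟨[x], rfl, by simpa using hx, ?_⟩
    rw [isWeaklyRegular_quotient_cons_iff]
    exact ⟨hxr, IsWeaklyRegular.nil _ _⟩

/-- The exact sequence `0 → R/(I ∩ J) → R/I × R/J → R/(I + J) → 0`. -/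
noncomputable def infSupShortComplex (I J : Ideal R) : ShortComplex (ModuleCat.{u} R) :=
  ModuleCat.shortComplexOfCompEqZero (R := R)
    (M := R ⧸ (I ⊓ J)) (N := (R ⧸ I) × (R ⧸ J)) (L := R ⧸ (I ⊔ J))
    ((Submodule.factor (p := I ⊓ J) inf_le_left).prod (Submodule.factor (p := I ⊓ J) inf_le_right))
    ((Submodule.factor (p := I) (p' := I ⊔ J) le_sup_left).coprod
      (-Submodule.factor (p := J) (p' := I ⊔ J) le_sup_right)) (by
        refine Submodule.linearMap_qext _ (LinearMap.ext fun f => ?_)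
        simp)

theorem infSupShortComplex_shortExact (I J : Ideal R) : (infSupShortComplex I J).ShortExact where
  exact := by
    refine ModuleCat.shortComplex_exact _ ?_
    rintro ⟨a, b⟩
    obtain ⟨a, rfl⟩ := Submodule.mkQ_surjective I a
    obtain ⟨b, rfl⟩ := Submodule.mkQ_surjective J b
    constructor
    · intro h
      have h' : a - b ∈ I ⊔ J := by
        rw [← Ideal.Quotient.mk_eq_mk_iff_sub_mem]
        exact sub_eq_zero.1 ((sub_eq_add_neg _ _).trans h)
      obtain ⟨u, hu, v, hv, huv⟩ := Submodule.mem_sup.1 h'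
      refine ⟨Submodule.mkQ (I ⊓ J) (a - u), Prod.ext ?_ ?_⟩
      · exact Ideal.Quotient.mk_eq_mk_iff_sub_mem _ _ |>.2 (by simpa using hu)
      · refine Ideal.Quotient.mk_eq_mk_iff_sub_mem _ _ |>.2 ?_
        have : a - u - b = v := by linear_combination -huv
        exact this ▸ hv
    · rintro ⟨c, hc⟩
      obtain ⟨c, rfl⟩ := Submodule.mkQ_surjective _ c
      rw [← hc]
      change Ideal.Quotient.mk (I ⊔ J) c + -Ideal.Quotient.mk (I ⊔ J) c = 0
      exact add_neg_cancel _
  mono_f := by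
    rw [ModuleCat.mono_iff_injective, injective_iff_map_eq_zero]
    intro c hc
    obtain ⟨c, rfl⟩ := Submodule.mkQ_surjective (I ⊓ J) c
    obtain ⟨h₁, h₂⟩ := Prod.ext_iff.1 hc
    exact Ideal.Quotient.eq_zero_iff_mem.2
      ⟨Ideal.Quotient.eq_zero_iff_mem.1 h₁, Ideal.Quotient.eq_zero_iff_mem.1 h₂⟩
  epi_g := by
    rw [ModuleCat.epi_iff_surjective]
    intro c
    obtain ⟨c, rfl⟩ := Submodule.mkQ_surjective (I ⊔ J) c
    refine ⟨(Submodule.mkQ I c, 0), ?_⟩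
    change Ideal.Quotient.mk (I ⊔ J) c + -0 = _
    rw [neg_zero, add_zero]
    rfl

theorem inlSnd_shortExact (M N : Type u) [AddCommGroup M] [AddCommGroup N] [Module R M]
    [Module R N] : (ModuleCat.shortComplexOfCompEqZero (LinearMap.inl R M N) (LinearMap.snd R M N)
      (by ext; simp)).ShortExact where
  exact := ModuleCat.shortComplex_exact _ Function.Exact.inl_snd
  mono_f := (ModuleCat.mono_iff_injective _).2 LinearMap.inl_injective
  epi_g := (ModuleCat.epi_iff_surjective _).2 LinearMap.snd_surjective

theorem subsingleton_ext_prod [IsNoetherianRing R] {𝔪 I J : Ideal R} (h𝔪 : 𝔪 ≠ ⊤)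
    (hI : I ≤ 𝔪) (hJ : J ≤ 𝔪) {n : ℕ} (hIn : HasRegularSequence 𝔪 I n)
    (hJn : HasRegularSequence 𝔪 J n) {i : ℕ} (hi : i < n) :
    Subsingleton (Ext (ModuleCat.of R (Shrink.{u} (R ⧸ 𝔪)))
      (infSupShortComplex I J).X₂ i) := by
  rw [hasRegularSequence_iff_ext h𝔪 hI] at hIn
  rw [hasRegularSequence_iff_ext h𝔪 hJ] at hJn
  exact subsingleton_ext_of_shortExact₂ (inlSnd_shortExact (R ⧸ I) (R ⧸ J)) _ (hIn i hi) (hJn i hi)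

/-- The depth lemma for `0 → R/(I ∩ J) → R/I × R/J → R/(I + J) → 0`: a lower bound for the depth
on the left. -/
theorem HasRegularSequence.inf [IsNoetherianRing R] {𝔪 I J : Ideal R} (h𝔪 : 𝔪 ≠ ⊤)
    (hI : I ≤ 𝔪) (hJ : J ≤ 𝔪) {n : ℕ} (hIn : HasRegularSequence 𝔪 I (n + 1))
    (hJn : HasRegularSequence 𝔪 J (n + 1)) (h : HasRegularSequence 𝔪 (I ⊔ J) n) :
    HasRegularSequence 𝔪 (I ⊓ J) (n + 1) := by
  rw [hasRegularSequence_iff_ext h𝔪 (sup_le hI hJ)] at h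
  rw [hasRegularSequence_iff_ext h𝔪 (inf_le_left.trans hI)]
  have hS := infSupShortComplex_shortExact I J
  rintro (_ | i) hi
  · exact subsingleton_ext_of_shortExact₁_zero hS _ (subsingleton_ext_prod h𝔪 hI hJ hIn hJn hi)
  · exact subsingleton_ext_of_shortExact₁ hS _ rfl (h i (by omega))
      (subsingleton_ext_prod h𝔪 hI hJ hIn hJn hi)

/-- The depth lemma for `0 → R/(I ∩ J) → R/I × R/J → R/(I + J) → 0`: a lower bound for the depth
on the right. -/
theorem HasRegularSequence.sup [IsNoetherianRing R] {𝔪 I J : Ideal R} (h𝔪 : 𝔪 ≠ ⊤)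
    (hI : I ≤ 𝔪) (hJ : J ≤ 𝔪) {n : ℕ} (hIn : HasRegularSequence 𝔪 I n)
    (hJn : HasRegularSequence 𝔪 J n) (h : HasRegularSequence 𝔪 (I ⊓ J) (n + 1)) :
    HasRegularSequence 𝔪 (I ⊔ J) n := by
  rw [hasRegularSequence_iff_ext h𝔪 (inf_le_left.trans hI)] at h
  rw [hasRegularSequence_iff_ext h𝔪 (sup_le hI hJ)]
  intro i hi
  exact subsingleton_ext_of_shortExact₃ (infSupShortComplex_shortExact I J) _ rfl
    (subsingleton_ext_prod h𝔪 hI hJ hIn hJn hi) (h (i + 1) (by omega))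

end Rees

/-! ### Ideals extended to a tensor product of polynomial rings -/

section TensorProducts

section OverAField

variable {k A B : Type*} [Field k] [CommRing A] [CommRing B] [Algebra k A] [Algebra k B]

theorem eq_zero_of_tmul_one_mul_eq_zero {a : A} (ha : IsSMulRegular A a) {t : A ⊗[k] B}
    (ht : (a ⊗ₜ 1) * t = 0) : t = 0 := by
  have hinj : Function.Injective (LinearMap.mulLeft k a) := ha
  have := Module.Flat.rTensor_preserves_injective_linearMap (M := B) _ hinj
  refine this ?_
  have h1 : LinearMap.rTensor B (LinearMap.mulLeft k a) = LinearMap.mulLeft k (a ⊗ₜ[k] (1 : B)) :=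
    TensorProduct.ext' fun x y => by simp
  rw [map_zero, h1, LinearMap.mulLeft_apply, ht]

theorem eq_zero_of_one_tmul_mul_eq_zero {b : B} (hb : IsSMulRegular B b) {t : A ⊗[k] B}
    (ht : (1 ⊗ₜ b) * t = 0) : t = 0 := by
  have hinj : Function.Injective (LinearMap.mulLeft k b) := hb
  have := Module.Flat.lTensor_preserves_injective_linearMap (M := A) _ hinj
  refine this ?_
  have h1 : LinearMap.lTensor A (LinearMap.mulLeft k b) = LinearMap.mulLeft k ((1 : A) ⊗ₜ[k] b) :=
    TensorProduct.ext' fun x y => by simp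
  rw [map_zero, h1, LinearMap.mulLeft_apply, ht]

theorem tmul_ne_zero_of_ne_zero {a : A} {b : B} (ha : a ≠ 0) (hb : b ≠ 0) :
    a ⊗ₜ[k] b ≠ 0 := by
  intro h
  rw [Ne, ← Module.forall_dual_apply_eq_zero_iff k] at ha hb
  push Not at ha hb
  obtain ⟨f, hf⟩ := ha
  obtain ⟨g, hg⟩ := hb
  have := congrArg (TensorProduct.lid k k ∘ TensorProduct.map f g) h
  simp [hf, hg] at this

/-- Over a field, `(I ⊗ B) ∩ (A ⊗ J) = I ⊗ J` inside `A ⊗ B`. -/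
theorem exists_map_subtype_eq_of_mem_map_inf (I : Ideal A) (J : Ideal B) {t : A ⊗[k] B}
    (hI : t ∈ I.map (Algebra.TensorProduct.includeLeft : A →ₐ[k] A ⊗[k] B))
    (hJ : t ∈ J.map (Algebra.TensorProduct.includeRight : B →ₐ[k] A ⊗[k] B)) :
    ∃ u, TensorProduct.map (I.restrictScalars k).subtype (J.restrictScalars k).subtype u = t := by
  rw [← Submodule.restrictScalars_mem k, Ideal.map_includeLeft_eq] at hI
  rw [← Submodule.restrictScalars_mem k, Ideal.map_includeRight_eq] at hJ
  obtain ⟨s, rfl⟩ := hI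
  obtain ⟨w, hw⟩ := hJ
  set q := (J.restrictScalars k).mkQ
  have hq : Function.Exact (J.restrictScalars k).subtype q := LinearMap.exact_subtype_mkQ _
  have hqs : Function.Surjective q := Submodule.mkQ_surjective _
  have h0 : LinearMap.lTensor (I.restrictScalars k) q s = 0 := by
    refine Module.Flat.rTensor_preserves_injective_linearMap (M := B ⧸ J.restrictScalars k)
      (I.restrictScalars k).subtype Subtype.val_injective ?_
    rw [map_zero, ← LinearMap.comp_apply, LinearMap.rTensor_comp_lTensor,
      ← LinearMap.lTensor_comp_rTensor, LinearMap.comp_apply, ← hw]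
    exact (lTensor_exact A hq hqs _).2 ⟨w, rfl⟩
  obtain ⟨u, rfl⟩ := (lTensor_exact _ hq hqs s).1 h0
  refine ⟨u, ?_⟩
  rw [← LinearMap.comp_apply, LinearMap.rTensor_comp_lTensor]

end OverAField

variable {k : Type*} [Field k] {σ τ : Type*}

/-- The extension to `k[σ ⊔ τ]` of an ideal of `k[σ]`. -/
noncomputable abbrev extLeft (τ : Type*) (I : Ideal (MvPolynomial σ k)) :
    Ideal (MvPolynomial (σ ⊕ τ) k) :=
  I.map (rename (R := k) (Sum.inl : σ → σ ⊕ τ))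

/-- The extension to `k[σ ⊔ τ]` of an ideal of `k[τ]`. -/
noncomputable abbrev extRight (σ : Type*) (J : Ideal (MvPolynomial τ k)) :
    Ideal (MvPolynomial (σ ⊕ τ) k) :=
  J.map (rename (R := k) (Sum.inr : τ → σ ⊕ τ))

theorem tensorEquivSum_tmul (a : MvPolynomial σ k) (b : MvPolynomial τ k) :
    tensorEquivSum k σ τ k (a ⊗ₜ b) = rename Sum.inl a * rename Sum.inr b := by
  have h₁ : ((tensorEquivSum k σ τ k).toAlgHom.comp Algebra.TensorProduct.includeLeft) =
      rename (R := k) (Sum.inl : σ → σ ⊕ τ) := algHom_ext fun i => by simp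
  have h₂ : ((tensorEquivSum k σ τ k).toAlgHom.comp Algebra.TensorProduct.includeRight) =
      rename (R := k) (Sum.inr : τ → σ ⊕ τ) := algHom_ext fun i => by simp
  have := congr($h₁ a * $h₂ b)
  rw [← this, ← mul_one a, ← one_mul b, ← Algebra.TensorProduct.tmul_mul_tmul, map_mul]
  simp

/-- The projection `k[σ ⊔ τ] → k[σ]/I ⊗ k[τ]/J`. -/
noncomputable def quotTensor (I : Ideal (MvPolynomial σ k)) (J : Ideal (MvPolynomial τ k)) :
    MvPolynomial (σ ⊕ τ) k →ₐ[k] (MvPolynomial σ k ⧸ I) ⊗[k] (MvPolynomial τ k ⧸ J) :=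
  (Algebra.TensorProduct.map (Ideal.Quotient.mkₐ k I) (Ideal.Quotient.mkₐ k J)).comp
    (tensorEquivSum k σ τ k).symm.toAlgHom

theorem quotTensor_mul (I : Ideal (MvPolynomial σ k)) (J : Ideal (MvPolynomial τ k))
    (a : MvPolynomial σ k) (b : MvPolynomial τ k) :
    quotTensor I J (rename Sum.inl a * rename Sum.inr b) =
      Ideal.Quotient.mk I a ⊗ₜ Ideal.Quotient.mk J b := by
  rw [← tensorEquivSum_tmul]
  simp [quotTensor]

theorem map_tensorEquivSum_includeLeft (I : Ideal (MvPolynomial σ k)) :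
    (I.map (Algebra.TensorProduct.includeLeft :
      MvPolynomial σ k →ₐ[k] MvPolynomial σ k ⊗[k] MvPolynomial τ k)).map
        (tensorEquivSum k σ τ k).toAlgHom = extLeft τ I := by
  rw [Ideal.map_mapₐ]
  congr 1
  exact algHom_ext fun i => by simp

theorem map_tensorEquivSum_includeRight (J : Ideal (MvPolynomial τ k)) :
    (J.map (Algebra.TensorProduct.includeRight :
      MvPolynomial τ k →ₐ[k] MvPolynomial σ k ⊗[k] MvPolynomial τ k)).map
        (tensorEquivSum k σ τ k).toAlgHom = extRight σ J := by
  rw [Ideal.map_mapₐ]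
  congr 1
  exact algHom_ext fun i => by simp

theorem tensorEquivSum_mem_map (K : Ideal (MvPolynomial σ k ⊗[k] MvPolynomial τ k))
    (t : MvPolynomial σ k ⊗[k] MvPolynomial τ k) :
    tensorEquivSum k σ τ k t ∈ K.map (tensorEquivSum k σ τ k).toAlgHom ↔ t ∈ K := by
  constructor
  · intro h
    obtain ⟨s, hs, hst⟩ := (Ideal.mem_map_iff_of_surjective (tensorEquivSum k σ τ k).toAlgHom
      (tensorEquivSum k σ τ k).surjective).1 h
    exact (tensorEquivSum k σ τ k).injective hst ▸ hs
  · exact fun h => Ideal.mem_map_of_mem (tensorEquivSum k σ τ k).toAlgHom h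

theorem quotTensor_eq_zero_iff (I : Ideal (MvPolynomial σ k)) (J : Ideal (MvPolynomial τ k))
    (f : MvPolynomial (σ ⊕ τ) k) : quotTensor I J f = 0 ↔ f ∈ extLeft τ I ⊔ extRight σ J := by
  obtain ⟨t, rfl⟩ := (tensorEquivSum k σ τ k).surjective f
  have hker := Algebra.TensorProduct.map_ker (Ideal.Quotient.mkₐ k I) (Ideal.Quotient.mkₐ k J)
    (Ideal.Quotient.mkₐ_surjective k I) (Ideal.Quotient.mkₐ_surjective k J)
  have hI : RingHom.ker (Ideal.Quotient.mkₐ k I) = I := Ideal.Quotient.mkₐ_ker k I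
  have hJ : RingHom.ker (Ideal.Quotient.mkₐ k J) = J := Ideal.Quotient.mkₐ_ker k J
  rw [hI, hJ] at hker
  rw [← map_tensorEquivSum_includeLeft, ← map_tensorEquivSum_includeRight, ← Ideal.map_sup, ← hker,
    tensorEquivSum_mem_map, RingHom.mem_ker]
  change Algebra.TensorProduct.map (Ideal.Quotient.mkₐ k I) (Ideal.Quotient.mkₐ k J)
    ((tensorEquivSum k σ τ k).symm (tensorEquivSum k σ τ k t)) = 0 ↔ _
  rw [AlgEquiv.symm_apply_apply]

/-- By flatness over `k`, a nonzerodivisor on `A/I` is one on `A/I ⊗ B/J`. -/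
theorem nonzerodivisor_extLeft {I : Ideal (MvPolynomial σ k)} (J : Ideal (MvPolynomial τ k))
    {a : MvPolynomial σ k} (ha : ∀ f, a * f ∈ I → f ∈ I) (f : MvPolynomial (σ ⊕ τ) k)
    (hf : rename Sum.inl a * f ∈ extLeft τ I ⊔ extRight σ J) :
    f ∈ extLeft τ I ⊔ extRight σ J := by
  rw [← quotTensor_eq_zero_iff] at hf ⊢
  refine eq_zero_of_tmul_one_mul_eq_zero (a := Ideal.Quotient.mk I a)
    ((isSMulRegular_quotient_iff I a).2 ha) ?_
  rw [← hf, map_mul, ← map_one (Ideal.Quotient.mk J), ← quotTensor_mul, map_one, mul_one]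

theorem nonzerodivisor_extRight (I : Ideal (MvPolynomial σ k)) {J : Ideal (MvPolynomial τ k)}
    {b : MvPolynomial τ k} (hb : ∀ f, b * f ∈ J → f ∈ J) (f : MvPolynomial (σ ⊕ τ) k)
    (hf : rename Sum.inr b * f ∈ extLeft τ I ⊔ extRight σ J) :
    f ∈ extLeft τ I ⊔ extRight σ J := by
  rw [← quotTensor_eq_zero_iff] at hf ⊢
  refine eq_zero_of_one_tmul_mul_eq_zero (b := Ideal.Quotient.mk J b)
    ((isSMulRegular_quotient_iff J b).2 hb) ?_
  rw [← hf, map_mul, ← map_one (Ideal.Quotient.mk I), ← quotTensor_mul, map_one, one_mul]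

theorem extLeft_sup_span (I : Ideal (MvPolynomial σ k)) (a : MvPolynomial σ k) :
    extLeft τ (I ⊔ Ideal.span {a}) = extLeft τ I ⊔ Ideal.span {rename Sum.inl a} := by
  rw [extLeft, Ideal.map_sup, Ideal.map_span, Set.image_singleton]

theorem extRight_sup_span (J : Ideal (MvPolynomial τ k)) (b : MvPolynomial τ k) :
    extRight σ (J ⊔ Ideal.span {b}) = extRight σ J ⊔ Ideal.span {rename Sum.inr b} := by
  rw [extRight, Ideal.map_sup, Ideal.map_span, Set.image_singleton]

theorem extLeft_sup_ofList (I : Ideal (MvPolynomial σ k)) (rs : List (MvPolynomial σ k)) :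
    extLeft τ (I ⊔ Ideal.ofList rs) =
      extLeft τ I ⊔ Ideal.ofList (rs.map (rename (Sum.inl : σ → σ ⊕ τ))) := by
  rw [extLeft, Ideal.map_sup]
  exact congrArg _ (Ideal.map_ofList _ _)

theorem extRight_sup_ofList (J : Ideal (MvPolynomial τ k)) (ss : List (MvPolynomial τ k)) :
    extRight σ (J ⊔ Ideal.ofList ss) =
      extRight σ J ⊔ Ideal.ofList (ss.map (rename (Sum.inr : τ → σ ⊕ τ))) := by
  rw [extRight, Ideal.map_sup]
  exact congrArg _ (Ideal.map_ofList _ _)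

theorem isWeaklyRegular_map_inl {I : Ideal (MvPolynomial σ k)} (J : Ideal (MvPolynomial τ k))
    {rs : List (MvPolynomial σ k)} (h : IsWeaklyRegular (MvPolynomial σ k ⧸ I) rs) :
    IsWeaklyRegular (MvPolynomial (σ ⊕ τ) k ⧸ (extLeft τ I ⊔ extRight σ J))
      (rs.map (rename (Sum.inl : σ → σ ⊕ τ))) := by
  induction rs generalizing I with
  | nil => simp
  | cons a rs ih =>
    rw [isWeaklyRegular_quotient_cons_iff] at h
    rw [List.map_cons, isWeaklyRegular_quotient_cons_iff, sup_right_comm, ← extLeft_sup_span]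
    exact ⟨nonzerodivisor_extLeft J h.1, ih h.2⟩

theorem isWeaklyRegular_map_inr (I : Ideal (MvPolynomial σ k)) {J : Ideal (MvPolynomial τ k)}
    {rs : List (MvPolynomial τ k)} (h : IsWeaklyRegular (MvPolynomial τ k ⧸ J) rs) :
    IsWeaklyRegular (MvPolynomial (σ ⊕ τ) k ⧸ (extLeft τ I ⊔ extRight σ J))
      (rs.map (rename (Sum.inr : τ → σ ⊕ τ))) := by
  induction rs generalizing J with
  | nil => simp
  | cons a rs ih =>
    rw [isWeaklyRegular_quotient_cons_iff] at h
    rw [List.map_cons, isWeaklyRegular_quotient_cons_iff, sup_assoc, ← extRight_sup_span]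
    exact ⟨nonzerodivisor_extRight I h.1, ih h.2⟩

theorem isWeaklyRegular_append_map {I : Ideal (MvPolynomial σ k)} {J : Ideal (MvPolynomial τ k)}
    {rs : List (MvPolynomial σ k)} {ss : List (MvPolynomial τ k)}
    (hI : IsWeaklyRegular (MvPolynomial σ k ⧸ I) rs)
    (hJ : IsWeaklyRegular (MvPolynomial τ k ⧸ J) ss) :
    IsWeaklyRegular (MvPolynomial (σ ⊕ τ) k ⧸ (extLeft τ I ⊔ extRight σ J))
      (rs.map (rename (Sum.inl : σ → σ ⊕ τ)) ++ ss.map (rename (Sum.inr : τ → σ ⊕ τ))) := by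
  rw [isWeaklyRegular_quotient_append_iff, sup_right_comm, ← extLeft_sup_ofList]
  exact ⟨isWeaklyRegular_map_inl J hI, isWeaklyRegular_map_inr _ hJ⟩

theorem extLeft_inf_extRight (I : Ideal (MvPolynomial σ k)) (J : Ideal (MvPolynomial τ k)) :
    extLeft τ I ⊓ extRight σ J = extProd I J := by
  refine le_antisymm ?_ Ideal.mul_le_inf
  rintro f ⟨hI, hJ⟩
  obtain ⟨t, rfl⟩ := (tensorEquivSum k σ τ k).surjective f
  rw [SetLike.mem_coe, ← map_tensorEquivSum_includeLeft, tensorEquivSum_mem_map] at hI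
  rw [SetLike.mem_coe, ← map_tensorEquivSum_includeRight, tensorEquivSum_mem_map] at hJ
  obtain ⟨u, rfl⟩ := exists_map_subtype_eq_of_mem_map_inf I J hI hJ
  clear hI hJ
  induction u using TensorProduct.induction_on with
  | zero => simp
  | tmul i j =>
    rw [TensorProduct.map_tmul, tensorEquivSum_tmul]
    exact Ideal.mul_mem_mul (Ideal.mem_map_of_mem _ i.2) (Ideal.mem_map_of_mem _ j.2)
  | add u v hu hv =>
    rw [map_add, map_add]
    exact add_mem hu hv

theorem rename_mem_idealOfVars {α β : Type*} (g : α → β) {f : MvPolynomial α k}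
    (hf : f ∈ idealOfVars α k) : rename g f ∈ idealOfVars β k := by
  have : (idealOfVars α k).map (rename (R := k) g) ≤ idealOfVars β k := by
    rw [Ideal.map_span, Ideal.span_le]
    rintro _ ⟨_, ⟨s, rfl⟩, rfl⟩
    rw [rename_X]
    exact Ideal.subset_span ⟨_, rfl⟩
  exact this (Ideal.mem_map_of_mem _ hf)

theorem extLeft_le_idealOfVars {I : Ideal (MvPolynomial σ k)} (hI : I ≤ idealOfVars σ k) :
    extLeft τ I ≤ idealOfVars (σ ⊕ τ) k :=
  Ideal.map_le_iff_le_comap.2 fun _ hf => rename_mem_idealOfVars _ (hI hf)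

theorem extRight_le_idealOfVars {J : Ideal (MvPolynomial τ k)} (hJ : J ≤ idealOfVars τ k) :
    extRight σ J ≤ idealOfVars (σ ⊕ τ) k :=
  Ideal.map_le_iff_le_comap.2 fun _ hf => rename_mem_idealOfVars _ (hJ hf)

theorem idealOfVars_ne_top : idealOfVars σ k ≠ ⊤ := by
  rw [Ne, Ideal.eq_top_iff_one]
  simpa using (C_mem_pow_idealOfVars_iff (σ := σ) (R := k) 1 1).not.2 (by simp)

theorem append_map_mem_idealOfVars {rs : List (MvPolynomial σ k)} {ss : List (MvPolynomial τ k)}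
    (hrs : ∀ r ∈ rs, r ∈ idealOfVars σ k) (hss : ∀ s ∈ ss, s ∈ idealOfVars τ k) :
    ∀ t ∈ rs.map (rename (Sum.inl : σ → σ ⊕ τ)) ++ ss.map (rename (Sum.inr : τ → σ ⊕ τ)),
      t ∈ idealOfVars (σ ⊕ τ) k := by
  simp only [List.mem_append, List.mem_map]
  rintro _ (⟨r, hr, rfl⟩ | ⟨r, hr, rfl⟩)
  · exact rename_mem_idealOfVars _ (hrs r hr)
  · exact rename_mem_idealOfVars _ (hss r hr)

theorem HasRegularSequence.extLeft_sup_extRight {I : Ideal (MvPolynomial σ k)}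
    {J : Ideal (MvPolynomial τ k)} {m n : ℕ} (hI : HasRegularSequence (idealOfVars σ k) I m)
    (hJ : HasRegularSequence (idealOfVars τ k) J n) :
    HasRegularSequence (idealOfVars (σ ⊕ τ) k) (extLeft τ I ⊔ extRight σ J) (m + n) := by
  obtain ⟨rs, rfl, hrs, hI⟩ := hI
  obtain ⟨ss, rfl, hss, hJ⟩ := hJ
  exact ⟨_, by simp, append_map_mem_idealOfVars hrs hss, isWeaklyRegular_append_map hI hJ⟩

/-- Socle elements `u` of `A/(I + (rs))` and `v` of `B/(J + (ss))` give the socle element `u ⊗ v`,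
so that the concatenation of two maximal regular sequences is maximal. -/
theorem not_hasRegularSequence_extLeft_sup_extRight [Finite σ] [Finite τ]
    {I : Ideal (MvPolynomial σ k)} {J : Ideal (MvPolynomial τ k)} {m n : ℕ}
    (hI𝔪 : I ≤ idealOfVars σ k) (hJ𝔪 : J ≤ idealOfVars τ k)
    (hI : HasRegularSequence (idealOfVars σ k) I m)
    (hI' : ¬ HasRegularSequence (idealOfVars σ k) I (m + 1))
    (hJ : HasRegularSequence (idealOfVars τ k) J n)
    (hJ' : ¬ HasRegularSequence (idealOfVars τ k) J (n + 1)) :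
    ¬ HasRegularSequence (idealOfVars (σ ⊕ τ) k) (extLeft τ I ⊔ extRight σ J) (m + n + 1) := by
  obtain ⟨rs, rfl, hrs, hI⟩ := hI
  obtain ⟨ss, rfl, hss, hJ⟩ := hJ
  obtain ⟨u, hu, hu𝔪⟩ :=
    (exists_socle_iff_not_hasRegularSequence idealOfVars_ne_top hI𝔪 hrs hI).2 hI'
  obtain ⟨v, hv, hv𝔪⟩ :=
    (exists_socle_iff_not_hasRegularSequence idealOfVars_ne_top hJ𝔪 hss hJ).2 hJ'
  have key := (exists_socle_iff_not_hasRegularSequence idealOfVars_ne_top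
    (sup_le (extLeft_le_idealOfVars hI𝔪) (extRight_le_idealOfVars hJ𝔪))
    (append_map_mem_idealOfVars hrs hss) (isWeaklyRegular_append_map hI hJ)).1
  rw [List.length_append, List.length_map, List.length_map, Ideal.ofList_append, sup_sup_sup_comm,
    ← extLeft_sup_ofList, ← extRight_sup_ofList] at key
  refine key ⟨rename Sum.inl u * rename Sum.inr v, ?_, ?_⟩
  · rw [← quotTensor_eq_zero_iff, quotTensor_mul]
    refine tmul_ne_zero_of_ne_zero ?_ ?_
    · rwa [Ne, Ideal.Quotient.eq_zero_iff_mem]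
    · rwa [Ne, Ideal.Quotient.eq_zero_iff_mem]
  · intro x hx
    induction hx using Submodule.span_induction with
    | zero => simp
    | add x y _ _ hx hy => exact (add_mul x y _).symm ▸ add_mem hx hy
    | smul c x _ hx => exact (mul_assoc c x _).symm ▸ Ideal.mul_mem_left _ c hx
    | mem x hx =>
      obtain ⟨i | j, rfl⟩ := hx
      · rw [← mul_assoc]
        refine Ideal.mul_mem_right _ _ (Ideal.mem_sup_left ?_)
        rw [← rename_X, ← map_mul]
        exact Ideal.mem_map_of_mem _ (hu𝔪 _ (Ideal.subset_span ⟨i, rfl⟩))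
      · rw [mul_left_comm]
        refine Ideal.mul_mem_left _ _ (Ideal.mem_sup_right ?_)
        rw [← rename_X (Sum.inr : τ → σ ⊕ τ), ← map_mul]
        exact Ideal.mem_map_of_mem _ (hv𝔪 _ (Ideal.subset_span ⟨j, rfl⟩))

end TensorProducts

/-! ### Krull dimension bounds the length of regular sequences -/

section KrullDimension

theorem ringKrullDim_quotient_sup_ofList_add_length_le {R : Type*} [CommRing R] (I : Ideal R)
    {rs : List R} (h : IsWeaklyRegular (R ⧸ I) rs) :
    ringKrullDim (R ⧸ (I ⊔ Ideal.ofList rs)) + rs.length ≤ ringKrullDim (R ⧸ I) := by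
  induction rs generalizing I with
  | nil => rw [Ideal.ofList_nil, sup_bot_eq]; simp
  | cons x rs ih =>
    rw [isWeaklyRegular_quotient_cons_iff] at h
    have h₁ := ih _ h.2
    have hx : Ideal.Quotient.mk I x ∈ nonZeroDivisors (R ⧸ I) := by
      rw [mem_nonZeroDivisors_iff_right]
      intro m hm
      obtain ⟨f, rfl⟩ := Ideal.Quotient.mk_surjective m
      rw [← map_mul, Ideal.Quotient.eq_zero_iff_mem, mul_comm] at hm
      exact Ideal.Quotient.eq_zero_iff_mem.2 (h.1 f hm)
    have h₂ := ringKrullDim_succ_le_of_surjective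
      (Ideal.Quotient.factor (le_sup_left : I ≤ I ⊔ Ideal.span {x}))
      (Ideal.Quotient.factor_surjective _) hx (by
        rw [Ideal.Quotient.factor_mk, Ideal.Quotient.eq_zero_iff_mem]
        exact Ideal.mem_sup_right (Ideal.mem_span_singleton_self x))
    rw [Ideal.ofList_cons, ← sup_assoc, List.length_cons, Nat.cast_add, ← add_assoc, Nat.cast_one]
    exact (add_le_add_left h₁ 1).trans h₂

variable {k : Type*} [Field k] {σ : Type*} [Finite σ]

/-- Regular sequences on the quotient by a nonzero ideal are shorter than the number of
variables. -/
theorem HasRegularSequence.succ_le_card {I : Ideal (MvPolynomial σ k)} (hI0 : I ≠ ⊥)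
    (hI : I ≤ idealOfVars σ k) {n : ℕ} (h : HasRegularSequence (idealOfVars σ k) I n) :
    n + 1 ≤ Nat.card σ := by
  obtain ⟨rs, rfl, hrs, hreg⟩ := h
  obtain ⟨f, hf, hf0⟩ := Submodule.exists_mem_ne_zero_of_ne_bot hI0
  have h₁ := ringKrullDim_quotient_sup_ofList_add_length_le I hreg
  have h₂ := ringKrullDim_succ_le_of_surjective (Ideal.Quotient.mk I)
    Ideal.Quotient.mk_surjective (mem_nonZeroDivisors_of_ne_zero hf0)
    (Ideal.Quotient.eq_zero_iff_mem.2 hf)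
  have hne : I ⊔ Ideal.ofList rs ≠ ⊤ := fun htop => idealOfVars_ne_top (k := k) (σ := σ)
    (top_le_iff.1 (htop ▸ sup_le hI (Ideal.span_le.2 hrs)))
  have := Ideal.Quotient.nontrivial_iff.2 hne
  have h₃ : (0 : WithBot ℕ∞) ≤ ringKrullDim (MvPolynomial σ k ⧸ (I ⊔ Ideal.ofList rs)) :=
    ringKrullDim_nonneg_of_nontrivial
  rw [MvPolynomial.ringKrullDim_of_isNoetherianRing, ringKrullDim_eq_zero_of_field, zero_add] at h₂
  have h₄ : (0 : WithBot ℕ∞) + rs.length + 1 ≤ Nat.card σ :=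
    (add_le_add_left ((add_le_add_left h₃ _).trans h₁) 1).trans h₂
  rw [zero_add] at h₄
  exact_mod_cast h₄

theorem exists_hasRegularSequence_maximal {I : Ideal (MvPolynomial σ k)} (hI0 : I ≠ ⊥)
    (hI : I ≤ idealOfVars σ k) : ∃ d, HasRegularSequence (idealOfVars σ k) I d ∧
      ¬ HasRegularSequence (idealOfVars σ k) I (d + 1) := by
  classical
  have hex : ∃ n, ¬ HasRegularSequence (idealOfVars σ k) I (n + 1) :=
    ⟨Nat.card σ, fun h => by have := h.succ_le_card hI0 hI; omega⟩
  refine ⟨Nat.find hex, ?_, Nat.find_spec hex⟩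
  rcases h : Nat.find hex with _ | d
  · exact ⟨[], rfl, by simp, IsWeaklyRegular.nil _ _⟩
  · exact not_not.1 (Nat.find_min hex (h ▸ Nat.lt_succ_self d))

end KrullDimension

/-! ### Regularity of variables and of their differences -/

section Variables

variable {k : Type*} [Field k] {σ τ : Type*}

theorem mem_span_X_image_of_X_mul_mem {s : Set σ} {i : σ} (hi : i ∉ s) {f : MvPolynomial σ k}
    (h : X i * f ∈ Ideal.span (X '' s : Set (MvPolynomial σ k))) :
    f ∈ Ideal.span (X '' s : Set (MvPolynomial σ k)) := by
  rw [mem_ideal_span_X_image] at h ⊢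
  intro m hm
  obtain ⟨j, hj, hmj⟩ := h (Finsupp.single i 1 + m) (by
    rw [support_X_mul]
    exact Finset.mem_map_of_mem (addLeftEmbedding (Finsupp.single i 1)) hm)
  refine ⟨j, hj, ?_⟩
  have : i ≠ j := fun hij => hi (hij ▸ hj)
  simpa [Finsupp.single_apply, this] using hmj

/-- The variables outside `s` form a regular sequence modulo the variables in `s`. -/
theorem isWeaklyRegular_map_X (s : Set σ) {l : List σ} (hl : l.Nodup) (hs : ∀ i ∈ l, i ∉ s) :
    IsWeaklyRegular (MvPolynomial σ k ⧸ Ideal.span (X '' s : Set (MvPolynomial σ k)))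
      (l.map (X : σ → MvPolynomial σ k)) := by
  induction l generalizing s with
  | nil => simp
  | cons i l ih =>
    rw [List.nodup_cons] at hl
    rw [List.map_cons, isWeaklyRegular_quotient_cons_iff]
    refine ⟨fun f hf => mem_span_X_image_of_X_mul_mem (hs i (by simp)) hf, ?_⟩
    rw [← Ideal.span_union, ← Set.image_singleton, ← Set.image_union]
    refine ih _ hl.2 fun j hj => ?_
    rintro (h | rfl)
    · exact hs j (by simp [hj]) h
    · exact hl.1 hj

theorem hasRegularSequence_bot [Finite σ] :
    HasRegularSequence (idealOfVars σ k) (⊥ : Ideal (MvPolynomial σ k)) (Nat.card σ) := by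
  have := Fintype.ofFinite σ
  refine ⟨Finset.univ.toList.map X, by simp, ?_, ?_⟩
  · simp only [List.mem_map]
    rintro _ ⟨i, -, rfl⟩
    exact Ideal.subset_span ⟨i, rfl⟩
  · have := isWeaklyRegular_map_X (k := k) (∅ : Set σ) (Finset.nodup_toList Finset.univ) (by simp)
    rwa [Set.image_empty, Ideal.span_empty] at this

/-- If an ideal is generated by polynomials not involving the variable `z`, and `z` is a
nonzerodivisor modulo it, then so is `w - z`: an automorphism preserving the ideal carries one to
the other. -/
theorem mem_map_rename_of_X_sub_X_mul_mem {g : σ → τ} (I : Ideal (MvPolynomial σ k)) {z w : τ}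
    (hz : z ∉ Set.range g) (hwz : w ≠ z)
    (hX : ∀ f, X z * f ∈ I.map (rename (R := k) g) → f ∈ I.map (rename (R := k) g))
    (f : MvPolynomial τ k) (hf : (X w - X z) * f ∈ I.map (rename (R := k) g)) :
    f ∈ I.map (rename (R := k) g) := by
  classical
  -- the involution fixing all variables but `z`, and sending `z` to `w - z`
  let θ : MvPolynomial τ k →ₐ[k] MvPolynomial τ k :=
    aeval fun t => if t = z then X w - X z else X t
  have hθz : θ (X z) = X w - X z := by simp [θ]
  have hθ : ∀ t, t ≠ z → θ (X t) = X t := fun t ht => by simp [θ, ht]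
  have hθθ : θ.comp θ = AlgHom.id k _ := algHom_ext fun t => by
    by_cases ht : t = z
    · simp [ht, hθz, hθ w hwz]
    · simp [hθ t ht]
  have hθg : θ.comp (rename g) = rename (R := k) g := algHom_ext fun i => by
    simp [hθ (g i) fun h => hz ⟨i, h⟩]
  have hmem : ∀ p ∈ I.map (rename (R := k) g), θ p ∈ I.map (rename (R := k) g) := by
    intro p hp
    have := Ideal.mem_map_of_mem θ hp
    rwa [Ideal.map_mapₐ, hθg] at this
  have h₁ := hmem _ hf
  rw [map_mul, map_sub, hθz, hθ w hwz, sub_sub_cancel] at h₁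
  have h₂ := hmem _ (hX _ h₁)
  rwa [← AlgHom.comp_apply, hθθ] at h₂

theorem mem_extProd_of_X_sub_X_mul_mem (I : Ideal (MvPolynomial σ k))
    (J : Ideal (MvPolynomial τ k)) (x : σ) (y : τ) (f : MvPolynomial (σ ⊕ τ) k)
    (hf : (X (Sum.inl x) - X (Sum.inr y)) * f ∈ extProd I J) : f ∈ extProd I J := by
  rw [← extLeft_inf_extRight] at hf ⊢
  refine ⟨mem_map_rename_of_X_sub_X_mul_mem I (z := Sum.inr y) (by simp) (by simp) ?_ f hf.1,
    mem_map_rename_of_X_sub_X_mul_mem J (z := Sum.inl x) (w := Sum.inr y) (by simp) (by simp)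
      ?_ f ?_⟩
  · intro p hp
    have := nonzerodivisor_extRight I (J := ⊥) (b := X y) (by simp) p
    rw [rename_X, extRight, Ideal.map_bot, sup_bot_eq] at this
    exact this hp
  · intro p hp
    have := nonzerodivisor_extLeft (I := ⊥) J (a := X x) (by simp) p
    rw [rename_X, extLeft, Ideal.map_bot, bot_sup_eq] at this
    exact this hp
  · have := neg_mem hf.2
    rwa [← neg_mul, neg_sub] at this

theorem extProd_le_idealOfVars {I : Ideal (MvPolynomial σ k)} {J : Ideal (MvPolynomial τ k)}
    (hI : I ≤ idealOfVars σ k) : extProd I J ≤ idealOfVars (σ ⊕ τ) k :=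
  (extLeft_inf_extRight I J).ge.trans (inf_le_left.trans (extLeft_le_idealOfVars hI))

end Variables

/-! ### The depth of the quotient by `IJ` after identifying two variables -/

section Depth

variable {k : Type*} [Field k] {σ τ : Type*} [Finite σ] [Finite τ]

/-- The middle term of `0 → R/IJ → R/IR × R/JR → R/(I + J) → 0` has depth greater than
`depth A/I + depth B/J`. -/
theorem hasRegularSequence_extLeft_and_extRight {I : Ideal (MvPolynomial σ k)}
    {J : Ideal (MvPolynomial τ k)} (hI0 : I ≠ ⊥) (hJ0 : J ≠ ⊥) (hI : I ≤ idealOfVars σ k)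
    (hJ : J ≤ idealOfVars τ k) {m n : ℕ} (hIm : HasRegularSequence (idealOfVars σ k) I m)
    (hJn : HasRegularSequence (idealOfVars τ k) J n) :
    HasRegularSequence (idealOfVars (σ ⊕ τ) k) (extLeft τ I) (m + n + 1) ∧
      HasRegularSequence (idealOfVars (σ ⊕ τ) k) (extRight σ J) (m + n + 1) := by
  have hm := hIm.succ_le_card hI0 hI
  have hn := hJn.succ_le_card hJ0 hJ
  have h₁ := hIm.extLeft_sup_extRight (hasRegularSequence_bot (k := k) (σ := τ))
  have h₂ := (hasRegularSequence_bot (k := k) (σ := σ)).extLeft_sup_extRight hJn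
  rw [extRight, Ideal.map_bot, sup_bot_eq] at h₁
  rw [extLeft, Ideal.map_bot, bot_sup_eq] at h₂
  exact ⟨h₁.mono (by omega), h₂.mono (by omega)⟩

theorem quotDepth_map_extProd {ρ : Type*} (I : Ideal (MvPolynomial σ k))
    (J : Ideal (MvPolynomial τ k)) (hI0 : I ≠ ⊥) (hJ0 : J ≠ ⊥) (hI : I ≤ idealOfVars σ k)
    (hJ : J ≤ idealOfVars τ k) (x : σ) (y : τ) {g : σ ⊕ τ → ρ} (hg : Function.Surjective g)
    (hker : RingHom.ker (rename (R := k) g) =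
      Ideal.span {X (Sum.inl x) - X (Sum.inr y)}) :
    quotDepth ((extProd I J).map (rename (R := k) g)) = quotDepth I + quotDepth J := by
  obtain ⟨m, hm, hm'⟩ := exists_hasRegularSequence_maximal hI0 hI
  obtain ⟨n, hn, hn'⟩ := exists_hasRegularSequence_maximal hJ0 hJ
  have h𝔪 := idealOfVars_ne_top (k := k) (σ := σ ⊕ τ)
  have hIext := extLeft_le_idealOfVars (τ := τ) hI
  have hJext := extRight_le_idealOfVars (σ := σ) hJ
  obtain ⟨hIr, hJr⟩ := hasRegularSequence_extLeft_and_extRight hI0 hJ0 hI hJ hm hn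
  have hprod : HasRegularSequence (idealOfVars (σ ⊕ τ) k) (extProd I J) (m + n + 1) := by
    rw [← extLeft_inf_extRight]
    exact HasRegularSequence.inf h𝔪 hIext hJext hIr hJr (hm.extLeft_sup_extRight hn)
  have hprod' : ¬ HasRegularSequence (idealOfVars (σ ⊕ τ) k) (extProd I J) (m + n + 1 + 1) := by
    rw [← extLeft_inf_extRight]
    exact fun h => not_hasRegularSequence_extLeft_sup_extRight hI hJ hm hm' hn hn'
      (HasRegularSequence.sup h𝔪 hIext hJext hIr hJr h)
  have hxy : (X (Sum.inl x) - X (Sum.inr y) : MvPolynomial (σ ⊕ τ) k) ∈ idealOfVars (σ ⊕ τ) k :=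
    sub_mem (Ideal.subset_span ⟨_, rfl⟩) (Ideal.subset_span ⟨_, rfl⟩)
  have hsurj : Function.Surjective (rename (R := k) g) := rename_surjective g hg
  have hmap𝔪 : (idealOfVars (σ ⊕ τ) k).map (rename (R := k) g) = idealOfVars ρ k := by
    rw [Ideal.map_span, ← Set.range_comp,
      show rename g ∘ X = (X : ρ → MvPolynomial ρ k) ∘ g from funext fun s => rename_X g s,
      hg.range_comp]
  have key : ∀ d, HasRegularSequence (idealOfVars ρ k) ((extProd I J).map (rename (R := k) g)) d ↔
      HasRegularSequence (idealOfVars (σ ⊕ τ) k) (extProd I J) (d + 1) := fun d => by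
    rw [← hmap𝔪, hasRegularSequence_map_map_iff hsurj, hker,
      hasRegularSequence_sup_span_iff h𝔪 (extProd_le_idealOfVars hI) hxy
        (mem_extProd_of_X_sub_X_mul_mem I J x y)]
  have hle : (extProd I J).map (rename (R := k) g) ≤ idealOfVars ρ k :=
    Ideal.map_le_iff_le_comap.2 fun _ hf => rename_mem_idealOfVars _ (extProd_le_idealOfVars hI hf)
  rw [quotDepth, quotDepth, quotDepth, idealDepth_quotient_eq idealOfVars_ne_top hI hm hm',
    idealDepth_quotient_eq idealOfVars_ne_top hJ hn hn',
    idealDepth_quotient_eq idealOfVars_ne_top hle ((key _).2 hprod)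
      (fun h => hprod' ((key _).1 h)), Nat.cast_add]

end Depth

/-! ### Identification of two variables -/

section Identification

variable {k : Type*} [Field k]

/-- Here `s` is a section of the gluing map `g` that sends the glued point to `a`. -/
theorem ker_rename_eq_span {α β : Type*} {g : α → β} {a b : α} (hab : g a = g b)
    (s : β → α) (hs : ∀ i, i ≠ b → s (g i) = i) (hsb : s (g b) = a) :
    RingHom.ker (rename (R := k) g) = Ideal.span {X a - X b} := by
  refine le_antisymm (fun f hf => ?_) ?_
  · have h : ((Ideal.Quotient.mkₐ k (Ideal.span {(X a - X b : MvPolynomial α k)})).comp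
        (rename s)).comp (rename g) = Ideal.Quotient.mkₐ k (Ideal.span {X a - X b}) := by
      refine algHom_ext fun i => ?_
      by_cases hi : i = b
      · subst hi
        simp only [AlgHom.comp_apply, rename_X, hsb]
        exact (Ideal.Quotient.mk_eq_mk_iff_sub_mem _ _).2 (Ideal.mem_span_singleton_self _)
      · simp [hs i hi]
    have h' := congr($h f)
    rw [AlgHom.comp_apply, (RingHom.mem_ker).1 hf, map_zero] at h'
    exact Ideal.Quotient.eq_zero_iff_mem.1 h'.symm
  · rw [Ideal.span_le, Set.singleton_subset_iff, SetLike.mem_coe, RingHom.mem_ker, map_sub,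
      rename_X, rename_X, hab, sub_self]

/-- The quotient of a polynomial ring by a difference `X a - X b` of two variables is a polynomial
ring in one variable less; `g` is the quotient map of the index set that glues `a` and `b`. -/
theorem exists_rename_ker_eq_span (k : Type*) [Field k] {α : Type*} [Finite α] {a b : α}
    (hab : a ≠ b) :
    ∃ (m : ℕ) (g : α → Fin m), Function.Surjective g ∧ Set.InjOn g {b}ᶜ ∧ Set.InjOn g {a}ᶜ ∧
      RingHom.ker (rename (R := k) g) = Ideal.span {X a - X b} := by
  classical
  obtain ⟨m, ⟨e⟩⟩ := Finite.exists_equiv_fin {i : α // i ≠ b}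
  let c : α → {i : α // i ≠ b} := fun i => if h : i = b then ⟨a, hab⟩ else ⟨i, h⟩
  have hcb : c b = ⟨a, hab⟩ := by simp [c]
  have hc : ∀ i (h : i ≠ b), c i = ⟨i, h⟩ := fun i h => by simp [c, h]
  have hinj : ∀ i j, i ≠ b → c i = c j → i = j ∨ (i = a ∧ j = b) := by
    intro i j hi hij
    by_cases hj : j = b
    · rw [hc i hi, hj, hcb] at hij
      exact Or.inr ⟨congrArg Subtype.val hij, hj⟩
    · rw [hc i hi, hc j hj] at hij
      exact Or.inl (congrArg Subtype.val hij)
  refine ⟨m, e ∘ c, e.surjective.comp fun i => ⟨i, hc i i.2⟩, ?_, ?_,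
    ker_rename_eq_span ?_ (fun j => (e.symm j).1) ?_ ?_⟩
  · intro i hi j hj hij
    exact (hinj i j hi (e.injective hij)).resolve_right fun h => hj h.2
  · intro i hi j hj hij
    by_cases hib : i = b
    · by_cases hjb : j = b
      · rw [hib, hjb]
      · exact ((hinj j i hjb (e.injective hij.symm)).resolve_right fun h => hj h.1).symm
    · exact (hinj i j hib (e.injective hij)).resolve_right fun h => hi h.1
  · simp [hcb, hc a hab]
  · intro i hi
    simp [hc i hi]
  · simp [hcb]

end Identification

/-! ### Homogeneous and monomial ideals -/

section Ideals

variable {k : Type*} [Field k] {σ τ : Type*}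

theorem IsHomogIdeal.le_idealOfVars {I : Ideal (MvPolynomial σ k)} (hI : IsHomogIdeal I)
    (hI1 : I ≠ ⊤) : I ≤ idealOfVars σ k := by
  intro f hf
  have h0 : C (coeff 0 f) ∈ I := by
    rw [← homogeneousComponent_zero]
    exact decomposition.decompose'_apply f 0 ▸ hI 0 hf
  have hc : coeff 0 f = 0 := by
    by_contra hne
    exact hI1 (Ideal.eq_top_of_isUnit_mem _ h0 ((IsUnit.mk0 _ hne).map C))
  rw [← pow_one (idealOfVars σ k), mem_pow_idealOfVars_iff']
  intro d hd
  rw [Nat.lt_one_iff, Finsupp.degree_eq_zero_iff] at hd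
  rwa [hd]

theorem IsHomogIdeal.map_rename {I : Ideal (MvPolynomial σ k)} (hI : IsHomogIdeal I)
    (g : σ → τ) : IsHomogIdeal (I.map (rename (R := k) g)) := by
  let := MvPolynomial.gradedAlgebra (σ := σ) (R := k)
  let := MvPolynomial.gradedAlgebra (σ := τ) (R := k)
  obtain ⟨S, rfl⟩ := (Ideal.IsHomogeneous.iff_exists (𝒜 := homogeneousSubmodule σ k) I).1 hI
  rw [Ideal.map_span]
  refine Ideal.homogeneous_span (homogeneousSubmodule τ k) _ ?_
  rintro _ ⟨_, ⟨⟨f, n, hf⟩, -, rfl⟩, rfl⟩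
  exact ⟨n, IsHomogeneous.rename_isHomogeneous hf⟩

theorem IsHomogIdeal.mul {I J : Ideal (MvPolynomial σ k)} (hI : IsHomogIdeal I)
    (hJ : IsHomogIdeal J) : IsHomogIdeal (I * J) :=
  letI := MvPolynomial.gradedAlgebra (σ := σ) (R := k)
  Ideal.IsHomogeneous.mul hI hJ

theorem IsMonomialIdeal.map_rename {I : Ideal (MvPolynomial σ k)} (hI : IsMonomialIdeal I)
    (g : σ → τ) : IsMonomialIdeal (I.map (rename (R := k) g)) := by
  obtain ⟨T, rfl⟩ := hI
  refine ⟨Finsupp.mapDomain g '' T, ?_⟩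
  rw [Ideal.map_span, Set.image_image, Set.image_image]
  simp only [rename_monomial]

theorem IsMonomialIdeal.mul {I J : Ideal (MvPolynomial σ k)} (hI : IsMonomialIdeal I)
    (hJ : IsMonomialIdeal J) : IsMonomialIdeal (I * J) := by
  obtain ⟨T, rfl⟩ := hI
  obtain ⟨U, rfl⟩ := hJ
  refine ⟨Set.image2 (· + ·) T U, ?_⟩
  rw [Ideal.span_mul_span', ← Set.image2_mul, Set.image2_image_left, Set.image2_image_right,
    Set.image_image2]
  simp [monomial_mul]

theorem extProd_pow (I : Ideal (MvPolynomial σ k)) (J : Ideal (MvPolynomial τ k)) (n : ℕ) :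
    extProd I J ^ n = extProd (I ^ n) (J ^ n) := by
  rw [extProd, extProd, mul_pow, Ideal.map_pow, Ideal.map_pow]

end Ideals

theorem proposition2p3 {k : Type*} [Field k] {σ τ : Type*} [Finite σ] [Finite τ]
    (I : Ideal (MvPolynomial σ k)) (J : Ideal (MvPolynomial τ k))
    (hI : IsHomogIdeal I) (hI0 : I ≠ ⊥) (hI1 : I ≠ ⊤)
    (hJ : IsHomogIdeal J) (hJ0 : J ≠ ⊥) (hJ1 : J ≠ ⊤) :
    Nonempty σ ∧ Nonempty τ ∧
    ∀ (x : σ) (y : τ),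
      ∃ (m : ℕ) (π : MvPolynomial (σ ⊕ τ) k →ₐ[k] MvPolynomial (Fin m) k)
        (Q : Ideal (MvPolynomial (Fin m) k)),
        -- `S = k[Fin m]` is `R/(x - y)`, the variables of `R` going to variables of `S`
        Function.Surjective π ∧
        RingHom.ker π =
          Ideal.span {MvPolynomial.X (Sum.inl x) - MvPolynomial.X (Sum.inr y)} ∧
        (∀ s, ∃ j, π (MvPolynomial.X s) = MvPolynomial.X j) ∧
        -- `Q` is the image of `IJ` in `S`
        Q = (extProd I J).map π ∧
        IsHomogIdeal Q ∧ Q ≠ ⊥ ∧ Q ≠ ⊤ ∧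
        (∀ n : ℕ, 0 < n → quotDepth (Q ^ n) = quotDepth (I ^ n) + quotDepth (J ^ n)) ∧
        (IsMonomialIdeal I → IsMonomialIdeal J → IsMonomialIdeal Q) := by
  have hI𝔪 := hI.le_idealOfVars hI1
  have hJ𝔪 := hJ.le_idealOfVars hJ1
  have hσ : Nonempty σ := by
    obtain ⟨d, hd, -⟩ := exists_hasRegularSequence_maximal hI0 hI𝔪
    exact (Nat.card_pos_iff.1 (by have := hd.succ_le_card hI0 hI𝔪; omega)).1
  have hτ : Nonempty τ := by
    obtain ⟨d, hd, -⟩ := exists_hasRegularSequence_maximal hJ0 hJ𝔪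
    exact (Nat.card_pos_iff.1 (by have := hd.succ_le_card hJ0 hJ𝔪; omega)).1
  refine ⟨hσ, hτ, fun x y => ?_⟩
  obtain ⟨m, g, hg, hgl, hgr, hker⟩ := exists_rename_ker_eq_span k
    (a := (Sum.inl x : σ ⊕ τ)) (b := Sum.inr y) (by simp)
  refine ⟨m, rename g, _, rename_surjective g hg, hker, fun s => ⟨g s, rename_X g s⟩, rfl,
    ((hI.map_rename _).mul (hJ.map_rename _)).map_rename g, ?_, ?_, ?_,
    fun hI hJ => ((hI.map_rename _).mul (hJ.map_rename _)).map_rename g⟩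
  · obtain ⟨f, hf, hf0⟩ := Submodule.exists_mem_ne_zero_of_ne_bot hI0
    obtain ⟨h, hh, hh0⟩ := Submodule.exists_mem_ne_zero_of_ne_bot hJ0
    have hmem := Ideal.mem_map_of_mem (rename (R := k) g) (Ideal.mul_mem_mul
      (Ideal.mem_map_of_mem (rename (R := k) (Sum.inl : σ → σ ⊕ τ)) hf)
      (Ideal.mem_map_of_mem (rename (R := k) (Sum.inr : τ → σ ⊕ τ)) hh))
    have hinl : Function.Injective (g ∘ Sum.inl) := fun i j hij =>
      Sum.inl_injective (hgl (by simp) (by simp) hij)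
    have hinr : Function.Injective (g ∘ Sum.inr) := fun i j hij =>
      Sum.inr_injective (hgr (by simp) (by simp) hij)
    refine Submodule.ne_bot_iff _ |>.2 ⟨_, hmem, ?_⟩
    rw [map_mul, rename_rename, rename_rename]
    exact mul_ne_zero ((map_ne_zero_iff _ (rename_injective _ hinl)).2 hf0)
      ((map_ne_zero_iff _ (rename_injective _ hinr)).2 hh0)
  · have hle : (extProd I J).map (rename (R := k) g) ≤ idealOfVars (Fin m) k :=
      Ideal.map_le_iff_le_comap.2 fun _ hf =>
        rename_mem_idealOfVars _ (extProd_le_idealOfVars hI𝔪 hf)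
    exact fun h => idealOfVars_ne_top (top_le_iff.1 (h ▸ hle))
  · intro n hn
    rw [← Ideal.map_pow, extProd_pow]
    exact quotDepth_map_extProd _ _ (pow_ne_zero n hI0) (pow_ne_zero n hJ0)
      ((Ideal.pow_le_self hn.ne').trans hI𝔪) ((Ideal.pow_le_self hn.ne').trans hJ𝔪) x y hg hker
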